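/- Let $m \ge 1$ and let $h : \mathbb{C} \to \mathbb{P}^m$ be an entire curve, i.e. a holomorphic map into complex projective $m$-space. Let $$T_h(r) := \int_0^r \frac{\mathrm{d}t}{t} \int_{|z|<t} h^*\omega_{\mathsf{FS}}, \qquad r \ge 0,$$ be its Nevanlinna–Shimizu–Ahlfors characteristic function, where $\omega_{\mathsf{FS}}$ is the Fubini–Study form on $\mathbb{P}^m$, normalized so that a projective line has area $1$. Suppose that for some constant $\epsilon > 0$, $$T_h(r) \le \epsilon \cdot r \qquad \text{for all } r > 0.$$ For $a \in \mathbb{C}$ let $\mathsf{T}_a$ be the translation operator $(\mathsf{T}_a f)(z) = f(z+a)$ on the space $\mathcal{O}(\mathbb{C},\mathbb{P}^m)$ of entire curves with the compact-open topology, and let $\mathsf{FHC}(\mathsf{T}_a)$ be the set of its frequently hypercyclic elements: those $f$ such that for every non-empty open set $U \subset \mathcal{O}(\mathbb{C},\mathbb{P}^m)$ the set $A = \{n \in \mathbb{N} : \mathsf{T}_a^n(f) \in U\}$ has positive lower density, i.e. $\liminf_{N\to\infty} \#\{n \le N : n \in A\}/N > 0$. Then the set $$E_h = \{\theta \in [0,2\pi)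 : h \in \mathsf{FHC}(\mathsf{T}_{e^{\sqrt{-1}\theta}})\}$$ is at most countable. -/

import Mathlib

open Set Filter Topology MeasureTheory
open scoped LinearAlgebra.Projectivization

noncomputable section

/-! ### Projective space and entire curves -/

/-- Complex projective space `ℙ^m`, the space of lines in `ℂ^{m+1}`. -/
abbrev ProjSpace (m : ℕ) : Type := ℙ ℂ (EuclideanSpace ℂ (Fin (m + 1)))

/-- `ℙ^m` carries the quotient topology from `ℂ^{m+1} ∖ {0}`. -/
instance ProjSpace.instTopologicalSpace (m : ℕ) : TopologicalSpace (ProjSpace m) :=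
  TopologicalSpace.coinduced
    (fun v : { v : EuclideanSpace ℂ (Fin (m + 1)) // v ≠ 0 } => Projectivization.mk ℂ v.1 v.2)
    inferInstance

/-- `F` is a holomorphic lift of `h : ℂ → ℙ^m` to `ℂ^{m+1} ∖ {0}` in a neighbourhood of `z₀`. -/
def IsLocalLift {m : ℕ} (h : ℂ → ProjSpace m) (z₀ : ℂ)
    (F : ℂ → EuclideanSpace ℂ (Fin (m + 1))) : Prop :=
  AnalyticAt ℂ F z₀ ∧ ∀ᶠ z in 𝓝 z₀, ∃ hz : F z ≠ 0, h z = Projectivization.mk ℂ (F z) hz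

/-- An entire curve in `ℙ^m`: a holomorphic map `ℂ → ℙ^m`, that is, a map which near every point
is given by homogeneous coordinates that are holomorphic without common zero. -/
@[ext]
structure EntireCurve (m : ℕ) where
  toFun : ℂ → ProjSpace m
  holomorphic' : ∀ z₀ : ℂ, ∃ F, IsLocalLift toFun z₀ F

namespace EntireCurve

variable {m : ℕ}

theorem continuous_toFun (h : EntireCurve m) : Continuous h.toFun := by
  rw [continuous_iff_continuousAt]
  intro z₀
  obtain ⟨F, hF, hh⟩ := h.holomorphic' z₀
  have hne : F z₀ ≠ 0 := hh.self_of_nhds.1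
  have hmk : Continuous (fun v : { v : EuclideanSpace ℂ (Fin (m + 1)) // v ≠ 0 } =>
      Projectivization.mk ℂ v.1 v.2) := continuous_coinduced_rng
  classical
  let G : ℂ → { v : EuclideanSpace ℂ (Fin (m + 1)) // v ≠ 0 } :=
    fun z => if hz : F z ≠ 0 then ⟨F z, hz⟩ else ⟨F z₀, hne⟩
  have hGF : ∀ᶠ z in 𝓝 z₀, (G z).1 = F z := by
    filter_upwards [hh] with z hz
    simp [G, hz.1]
  have hG : ContinuousAt G z₀ := by
    refine Topology.IsInducing.subtypeVal.continuousAt_iff.2 ?_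
    exact hF.continuousAt.congr (hGF.mono fun z hz => hz.symm)
  refine (hmk.continuousAt.comp hG).congr ?_
  filter_upwards [hh, hGF] with z hz hz'
  rw [hz.2]
  simp only [Function.comp]
  congr 1

/-- The underlying continuous map of an entire curve. -/
def toContinuousMap (h : EntireCurve m) : C(ℂ, ProjSpace m) := ⟨h.toFun, h.continuous_toFun⟩

/-- The compact-open topology on the space `𝒪(ℂ, ℙ^m)` of entire curves. -/
instance instTopologicalSpace : TopologicalSpace (EntireCurve m) :=
  TopologicalSpace.induced toContinuousMap inferInstance

/-- The translate `z ↦ h (z + a)`. -/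
def translate (a : ℂ) (h : EntireCurve m) : EntireCurve m where
  toFun z := h.toFun (z + a)
  holomorphic' z₀ := by
    obtain ⟨F, hF, hh⟩ := h.holomorphic' (z₀ + a)
    refine ⟨fun z => F (z + a), ?_, ?_⟩
    · exact AnalyticAt.fun_comp (g := F) (f := fun z => z + a) hF (by fun_prop)
    · have hc : Tendsto (fun z : ℂ => z + a) (𝓝 z₀) (𝓝 (z₀ + a)) :=
        (continuous_id.add continuous_const).tendsto z₀
      exact hc.eventually hh

/-- The translation operator `𝖳_a : 𝒪(ℂ, ℙ^m) → 𝒪(ℂ, ℙ^m)`, `(𝖳_a h)(z) = h (z + a)`. -/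
def translation (m : ℕ) (a : ℂ) : C(EntireCurve m, EntireCurve m) where
  toFun := translate a
  continuous_toFun := by
    have hτ : Continuous (fun f : C(ℂ, ProjSpace m) =>
        f.comp (⟨fun z => z + a, by fun_prop⟩ : C(ℂ, ℂ))) := ContinuousMap.continuous_precomp _
    have hi : Continuous (toContinuousMap (m := m)) := continuous_induced_dom
    exact continuous_induced_rng.2 (hτ.comp hi)

end EntireCurve

/-! ### The Fubini–Study form and the characteristic function -/

/-- The Fubini–Study form `ω_FS = (i / 2π) ∂∂̄ log ‖Z‖²` in homogeneous coordinates, at the point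
`Z ≠ 0` of `ℂ^{m+1}` and evaluated on tangent vectors `v`, `w`. With this normalization a
projective line has area `1`. -/
def fubiniStudyForm {m : ℕ} (Z v w : EuclideanSpace ℂ (Fin (m + 1))) : ℝ :=
  1 / Real.pi *
    (((‖Z‖ : ℂ) ^ 2 * inner ℂ v w - inner ℂ v Z * inner ℂ Z w) / (‖Z‖ : ℂ) ^ 4).im

/-- The form descends to `ℙ^m`: it is invariant under rescaling of `Z` and does not see the
components of tangent vectors along the line spanned by `Z`. -/
theorem fubiniStudyForm_smul_add {m : ℕ} (Z v w : EuclideanSpace ℂ (Fin (m + 1)))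
    (c a b : ℂ) (hc : c ≠ 0) :
    fubiniStudyForm (c • Z) (c • v + a • Z) (c • w + b • Z) = fubiniStudyForm Z v w := by
  unfold fubiniStudyForm
  congr 2
  by_cases hZ : Z = 0
  · simp [hZ]
  have hn : (‖Z‖ : ℂ) ≠ 0 := by simpa using hZ
  have hcn : (‖c‖ : ℂ) ≠ 0 := by simpa using hc
  have hcc : (starRingEnd ℂ) c * c = (‖c‖ : ℂ) ^ 2 := Complex.conj_mul' c
  have hZZ : inner ℂ Z Z = (‖Z‖ : ℂ) ^ 2 := inner_self_eq_norm_sq_to_K Z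
  simp only [inner_add_left, inner_add_right, inner_smul_left, inner_smul_right, norm_smul,
    Complex.ofReal_mul, hZZ]
  rw [div_eq_div_iff (by positivity) (by positivity)]
  have hcc4 : (‖c‖ : ℂ) ^ 4 = ((starRingEnd ℂ) c * c) ^ 2 := by rw [hcc]; ring
  rw [mul_pow, mul_pow, ← hcc, hcc4]
  ring

namespace EntireCurve

variable {m : ℕ}

/-- The density of `h^* ω_FS` with respect to Lebesgue measure `dx dy` on `ℂ`: the value of the
pulled-back form on `(∂/∂x, ∂/∂y)`, computed through a local holomorphic lift `F`, whose partial
derivatives are `F'` and `i F'`. It does not depend on the lift,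
see `pullbackDensity_eq`. -/
def pullbackDensity (h : EntireCurve m) (z : ℂ) : ℝ :=
  let F := Classical.choose (h.holomorphic' z)
  fubiniStudyForm (F z) (deriv F z) (Complex.I • deriv F z)

theorem pullbackDensity_eq (h : EntireCurve m) (z : ℂ)
    (G : ℂ → EuclideanSpace ℂ (Fin (m + 1))) (hG : IsLocalLift h.toFun z G) :
    h.pullbackDensity z = fubiniStudyForm (G z) (deriv G z) (Complex.I • deriv G z) := by
  unfold pullbackDensity
  obtain ⟨hF, hFh⟩ := Classical.choose_spec (h.holomorphic' z)
  generalize Classical.choose (h.holomorphic' z) = F at hF hFh ⊢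
  obtain ⟨hG, hGh⟩ := hG
  have hF0 : F z ≠ 0 := hFh.self_of_nhds.1
  obtain ⟨hG0, hGz⟩ := hGh.self_of_nhds
  have hex : ∀ᶠ x in 𝓝 z, ∃ c : ℂ, c ≠ 0 ∧ G x = c • F x := by
    filter_upwards [hFh, hGh] with x hx hx'
    obtain ⟨h1, h2⟩ := hx
    obtain ⟨h3, h4⟩ := hx'
    rw [h2, eq_comm, Projectivization.mk_eq_mk_iff'] at h4
    obtain ⟨c, hc⟩ := h4
    refine ⟨c, ?_, hc.symm⟩
    rintro rfl
    exact h3 (by rw [← hc, zero_smul])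
  -- the factor `l = G / F` is holomorphic near `z`
  let l : ℂ → ℂ := fun x => inner ℂ (F z) (G x) / inner ℂ (F z) (F x)
  have hFd : DifferentiableAt ℂ F z := hF.differentiableAt
  have hGd : DifferentiableAt ℂ G z := hG.differentiableAt
  have hne : inner ℂ (F z) (F z) ≠ 0 := inner_self_ne_zero.2 hF0
  have hl : DifferentiableAt ℂ l z :=
    ((innerSL ℂ (F z)).differentiableAt.comp z hGd).div
      ((innerSL ℂ (F z)).differentiableAt.comp z hFd) hne
  have hcont : ContinuousAt (fun x => inner ℂ (F z) (F x)) z :=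
    ((innerSL ℂ (F z)).differentiableAt.comp z hFd).continuousAt
  have hGl : G =ᶠ[𝓝 z] fun x => l x • F x := by
    filter_upwards [hex, hcont.eventually_ne hne] with x hx hx'
    obtain ⟨c, -, hc⟩ := hx
    have : l x = c := by
      simp only [l, hc, inner_smul_right]
      field_simp
    rw [this, hc]
  have hlz : l z ≠ 0 := by
    intro h0
    exact hG0 (by rw [hGl.self_of_nhds]; simp [h0])
  have hder : deriv G z = l z • deriv F z + deriv l z • F z := by
    rw [hGl.deriv_eq, deriv_fun_smul hl hFd]
  have hval : G z = l z • F z := hGl.self_of_nhds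
  have hI : Complex.I • deriv G z =
      l z • (Complex.I • deriv F z) + (Complex.I * deriv l z) • F z := by
    rw [hder, smul_add, smul_smul, smul_smul, smul_smul, mul_comm Complex.I (l z)]
  rw [hI, hder, hval, fubiniStudyForm_smul_add _ _ _ _ _ _ hlz]

theorem continuous_pullbackDensity (h : EntireCurve m) : Continuous h.pullbackDensity := by
  rw [continuous_iff_continuousAt]
  intro z₀
  obtain ⟨F, hF, hh⟩ := h.holomorphic' z₀
  have hne : F z₀ ≠ 0 := hh.self_of_nhds.1
  have heq : ∀ᶠ z in 𝓝 z₀, fubiniStudyForm (F z) (deriv F z) (Complex.I • deriv F z) =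
      h.pullbackDensity z := by
    filter_upwards [hF.eventually_analyticAt, hh.eventually_nhds] with z h1 h2
    exact (h.pullbackDensity_eq z F ⟨h1, h2⟩).symm
  refine ContinuousAt.congr ?_ heq
  have c1 : ContinuousAt F z₀ := hF.continuousAt
  have c2 : ContinuousAt (deriv F) z₀ := hF.deriv.continuousAt
  have c3 : ContinuousAt (fun z => (‖F z‖ : ℂ)) z₀ :=
    Complex.continuous_ofReal.continuousAt.comp c1.norm
  have hn : (‖F z₀‖ : ℂ) ^ 4 ≠ 0 := by simpa using hne
  have c4 : ContinuousAt (fun z => Complex.I • deriv F z) z₀ :=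
    (continuous_const_smul Complex.I).continuousAt.comp c2
  unfold fubiniStudyForm
  refine continuousAt_const.mul (Complex.continuous_im.continuousAt.comp ?_)
  exact (((c3.pow 2).mul (ContinuousAt.inner (𝕜 := ℂ) c2 c4)).sub ((ContinuousAt.inner (𝕜 := ℂ) c2 c1).mul (ContinuousAt.inner (𝕜 := ℂ) c1 c4))).div
    (c3.pow 4) hn

/-- The Nevanlinna–Shimizu–Ahlfors characteristic function
`T_h(r) = ∫₀ʳ (dt / t) ∫_{|z| < t} h^* ω_FS`. -/
def characteristic (h : EntireCurve m) (r : ℝ) : ℝ :=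
  ∫ t in (0 : ℝ)..r, (∫ z in Metric.ball (0 : ℂ) t, h.pullbackDensity z) / t

end EntireCurve

/-! ### Frequent hypercyclicity -/

/-- The lower density `liminf_{N → ∞} #{n ≤ N : n ∈ A} / N` of a set of natural numbers. -/
def lowerDensity (A : Set ℕ) : ℝ :=
  liminf (fun N : ℕ => ({n : ℕ | n ≤ N ∧ n ∈ A}.ncard : ℝ) / N) atTop

/-- The set of frequently hypercyclic elements of a continuous operator `T` on a topological
space `V`. -/
def FHC {V : Type*} [TopologicalSpace V] (T : C(V, V)) : Set V :=
  {x | ∀ U : Set V, IsOpen U → U.Nonempty → 0 < lowerDensity {n : ℕ | (⇑T)^[n] x ∈ U}}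

end

/-! Each visit of a translate of `h` to a neighbourhood of a fixed nonconstant curve costs a fixed
amount of area, and linear growth of the characteristic limits the total. If a translate by `n * exp
(I * θ)` is near the line on the unit disc, `h` has area at least `1 / 1024` in the disc of radius
`1 / 4` about that point (`le_pullbackDensity_of_mem_nearLine`, `card_le_discArea`). These discs are
disjoint along one ray and, away from the origin, across finitely many rays. So `K` directions of
lower density above `δ` force area at least `K * δ / 2048 * t` for large `t` (`exists_le_discArea`),
hence a characteristic of at least that slope (`le_characteristic`). The bound `ε * r` then leaves
finitely many directions for each `δ`; taking `δ = 1 / (k + 1)` and the union over `k` gives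
countability. -/

namespace ProjSpace

/-! ### The affine chart of projective space -/

variable {m : ℕ}

/-- The affine coordinates `Z / Z₀` of the point `[Z]`, with `Z / 0 = 0`. -/
noncomputable def affineChart (p : ProjSpace m) : EuclideanSpace ℂ (Fin (m + 1)) :=
  Projectivization.lift (fun v : { v : EuclideanSpace ℂ (Fin (m + 1)) // v ≠ 0 } =>
    (v.1 0)⁻¹ • v.1) (by
      rintro ⟨v, hv⟩ ⟨w, hw⟩ t h
      simp only at h ⊢
      subst h
      have ht : t ≠ 0 := by rintro rfl; simp at hv
      rw [smul_smul, PiLp.smul_apply, smul_eq_mul, mul_inv, mul_assoc, mul_comm (w 0)⁻¹,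
        ← mul_assoc, inv_mul_cancel₀ ht, one_mul]) p

theorem affineChart_mk (v : EuclideanSpace ℂ (Fin (m + 1))) (hv : v ≠ 0) :
    affineChart (Projectivization.mk ℂ v hv) = (v 0)⁻¹ • v := rfl

/-- The domain `Z₀ ≠ 0` of the affine chart. -/
def affineDomain (m : ℕ) : Set (ProjSpace m) := {p | affineChart p 0 = 1}

theorem mk_mem_affineDomain {v : EuclideanSpace ℂ (Fin (m + 1))} (hv : v ≠ 0) :
    Projectivization.mk ℂ v hv ∈ affineDomain m ↔ v 0 ≠ 0 := by
  simp only [affineDomain, mem_ofPred_eq, affineChart_mk, PiLp.smul_apply, smul_eq_mul]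
  constructor
  · intro h h0
    simp [h0] at h
  · exact inv_mul_cancel₀

theorem isOpen_affineDomain : IsOpen (affineDomain m) := by
  rw [isOpen_coinduced]
  have : (fun v : { v : EuclideanSpace ℂ (Fin (m + 1)) // v ≠ 0 } =>
      Projectivization.mk ℂ v.1 v.2) ⁻¹' affineDomain m = {v | v.1 0 ≠ 0} := by
    ext v
    exact mk_mem_affineDomain v.2
  rw [this]
  exact isOpen_ne_fun (by fun_prop) continuous_const

theorem continuousOn_affineChart : ContinuousOn affineChart (affineDomain m) := by
  -- The quotient topology tests open sets upstairs, so continuity is first turned into openness of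
  -- preimages.
  rw [continuousOn_open_iff isOpen_affineDomain]
  intro t ht
  rw [isOpen_coinduced]
  have : (fun v : { v : EuclideanSpace ℂ (Fin (m + 1)) // v ≠ 0 } =>
      Projectivization.mk ℂ v.1 v.2) ⁻¹' (affineDomain m ∩ affineChart ⁻¹' t) =
      {v | v.1 0 ≠ 0} ∩ (fun v => (v.1 0)⁻¹ • v.1) ⁻¹' t := by
    ext v
    exact and_congr (mk_mem_affineDomain v.2) Iff.rfl
  rw [this]
  have h0 : Continuous fun v : { v : EuclideanSpace ℂ (Fin (m + 1)) // v ≠ 0 } => v.1 0 := by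
    fun_prop
  refine ContinuousOn.isOpen_inter_preimage ?_ (isOpen_ne_fun h0 continuous_const) ht
  exact (h0.continuousOn.inv₀ fun v hv => hv).smul continuous_subtype_val.continuousOn

theorem affineChart_ne_zero {p : ProjSpace m} (hp : p ∈ affineDomain m) : affineChart p ≠ 0 := by
  intro h
  have : affineChart p 0 = 1 := hp
  simp [h] at this

theorem mk_affineChart {p : ProjSpace m} (hp : p ∈ affineDomain m) :
    Projectivization.mk ℂ (affineChart p) (affineChart_ne_zero hp) = p := by
  induction p using Projectivization.ind with
  | h v hv =>
    rw [Projectivization.mk_eq_mk_iff']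
    exact ⟨(v 0)⁻¹, (affineChart_mk v hv).symm⟩

end ProjSpace

open ProjSpace

/-! ### Lower bound for the Fubini–Study area -/

theorem fubiniStudyForm_I_smul {m : ℕ} (Z v : EuclideanSpace ℂ (Fin (m + 1))) :
    fubiniStudyForm Z v (Complex.I • v) =
      1 / Real.pi * ((‖Z‖ ^ 2 * ‖v‖ ^ 2 - ‖inner ℂ Z v‖ ^ 2) / ‖Z‖ ^ 4) := by
  unfold fubiniStudyForm
  congr 1
  have h1 : inner ℂ v Z * inner ℂ Z v = ((‖inner ℂ Z v‖ : ℝ) : ℂ) ^ 2 := by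
    rw [← inner_conj_symm v Z]
    exact Complex.conj_mul' _
  have h2 : inner ℂ v v = (‖v‖ : ℂ) ^ 2 := inner_self_eq_norm_sq_to_K v
  have : ((‖Z‖ : ℂ) ^ 2 * inner ℂ v (Complex.I • v) - inner ℂ v Z * inner ℂ Z (Complex.I • v)) /
      (‖Z‖ : ℂ) ^ 4 =
      (((‖Z‖ ^ 2 * ‖v‖ ^ 2 - ‖inner ℂ Z v‖ ^ 2) / ‖Z‖ ^ 4 : ℝ) : ℂ) * Complex.I := by
    rw [inner_smul_right, inner_smul_right, mul_left_comm (inner ℂ v Z), h1, h2]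
    push_cast
    ring
  rw [this, Complex.im_ofReal_mul, Complex.I_im, mul_one]

theorem fubiniStudyForm_I_smul_nonneg {m : ℕ} (Z v : EuclideanSpace ℂ (Fin (m + 1))) :
    0 ≤ fubiniStudyForm Z v (Complex.I • v) := by
  rw [fubiniStudyForm_I_smul]
  have : ‖inner ℂ Z v‖ ^ 2 ≤ (‖Z‖ * ‖v‖) ^ 2 :=
    pow_le_pow_left₀ (norm_nonneg _) (norm_inner_le_norm Z v) 2
  rw [mul_pow] at this
  have := sub_nonneg.2 this
  positivity

/-- In affine coordinates the Fubini–Study area is at least `‖v‖² / (π ‖Z‖⁴)`. -/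
theorem le_fubiniStudyForm_I_smul {m : ℕ} (Z v : EuclideanSpace ℂ (Fin (m + 1)))
    (hZ : Z 0 = 1) (hv : v 0 = 0) :
    1 / Real.pi * (‖v‖ ^ 2 / ‖Z‖ ^ 4) ≤ fubiniStudyForm Z v (Complex.I • v) := by
  rw [fubiniStudyForm_I_smul]
  -- Both `v` and `Z - e` are orthogonal to `e`. The Gram determinant of `Z, v` is therefore `‖v‖²`
  -- plus that of `Z - e, v`, which is nonnegative by Cauchy–Schwarz.
  set e : EuclideanSpace ℂ (Fin (m + 1)) := EuclideanSpace.single 0 1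
  have hev : inner ℂ e v = 0 := by simp [e, EuclideanSpace.inner_single_left, hv]
  have heZ : inner ℂ e (Z - e) = 0 := by
    simp [e, EuclideanSpace.inner_single_left, hZ]
  have hZn : ‖Z‖ ^ 2 = 1 + ‖Z - e‖ ^ 2 := by
    have := norm_add_sq_eq_norm_sq_add_norm_sq_of_inner_eq_zero e (Z - e) heZ
    have he : ‖e‖ = 1 := by simp [e]
    rw [add_sub_cancel, he] at this
    nlinarith
  have hin : inner ℂ Z v = inner ℂ (Z - e) v := by rw [inner_sub_left, hev, sub_zero]
  have : ‖inner ℂ (Z - e) v‖ ^ 2 ≤ (‖Z - e‖ * ‖v‖) ^ 2 :=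
    pow_le_pow_left₀ (norm_nonneg _) (norm_inner_le_norm _ v) 2
  rw [mul_pow] at this
  gcongr
  rw [hin, hZn]
  linarith

/-! ### Translates and curves near a line -/

namespace EntireCurve

variable {m : ℕ}

theorem pullbackDensity_nonneg (h : EntireCurve m) (z : ℂ) : 0 ≤ h.pullbackDensity z :=
  fubiniStudyForm_I_smul_nonneg _ _

theorem pullbackDensity_translate (h : EntireCurve m) (a z : ℂ) :
    (h.translate a).pullbackDensity z = h.pullbackDensity (z + a) := by
  obtain ⟨F, hF, hh⟩ := h.holomorphic' (z + a)
  have hc : Tendsto (fun z : ℂ => z + a) (𝓝 z) (𝓝 (z + a)) :=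
    (continuous_id.add continuous_const).tendsto z
  rw [h.pullbackDensity_eq _ F ⟨hF, hh⟩, (h.translate a).pullbackDensity_eq z (fun z => F (z + a))
    ⟨AnalyticAt.fun_comp (g := F) (f := fun z => z + a) hF (by fun_prop), hc.eventually hh⟩,
    deriv_comp_add_const]

theorem iterate_translation_toFun (h : EntireCurve m) (a : ℂ) (n : ℕ) :
    (translation m a)^[n] h = h.translate (n * a) := by
  induction n with
  | zero => ext z; simp [translate]
  | succ n ih =>
    rw [Function.iterate_succ_apply', ih]
    apply EntireCurve.ext
    funext z
    change h.toFun (z + a + n * a) = h.toFun (z + (n + 1 : ℕ) * a)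
    congr 1
    push_cast
    ring

theorem isLocalLift_affineChart (f : EntireCurve m) {z : ℂ} (hz : f.toFun z ∈ affineDomain m) :
    IsLocalLift f.toFun z (fun w => affineChart (f.toFun w)) := by
  have hev : ∀ᶠ w in 𝓝 z, f.toFun w ∈ affineDomain m :=
    f.continuous_toFun.continuousAt.eventually_mem (isOpen_affineDomain.mem_nhds hz)
  refine ⟨?_, hev.mono fun w hw => ⟨affineChart_ne_zero hw, (mk_affineChart hw).symm⟩⟩
  obtain ⟨F, hF, hh⟩ := f.holomorphic' z
  have hF0 : F z 0 ≠ 0 := by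
    obtain ⟨h1, h2⟩ := hh.self_of_nhds
    rwa [h2, mk_mem_affineDomain] at hz
  have hF0a : AnalyticAt ℂ (fun w => F w 0) z :=
    ((EuclideanSpace.proj 0 : EuclideanSpace ℂ (Fin (m + 1)) →L[ℂ] ℂ).analyticAt _).comp hF
  refine ((hF0a.inv hF0).smul hF).congr ?_
  filter_upwards [hh] with w hw
  obtain ⟨h1, h2⟩ := hw
  rw [h2, affineChart_mk]
  rfl

/-- The curves which on the closed unit disc are close to the line `z ↦ [1 : 0 : ⋯ : 0 : z]`. -/
def nearLine (m : ℕ) : Set (EntireCurve m) :=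
  {f | ∀ z ∈ Metric.closedBall (0 : ℂ) 1, f.toFun z ∈ affineDomain m ∧
    ‖affineChart (f.toFun z)‖ < 2 ∧ ‖affineChart (f.toFun z) (Fin.last m) - z‖ < 1 / 4}

/-- The condition involves `z` as well as `f z`, so it is read on the graph map `z ↦ (z, f z)`,
which must send a compact disc into an open set. -/
theorem isOpen_nearLine : IsOpen (nearLine m) := by
  let W : Set (ℂ × ProjSpace m) := {q | q.2 ∈ affineDomain m ∧
    ‖affineChart q.2‖ < 2 ∧ ‖affineChart q.2 (Fin.last m) - q.1‖ < 1 / 4}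
  have hD : IsOpen {q : ℂ × ProjSpace m | q.2 ∈ affineDomain m} :=
    isOpen_affineDomain.preimage continuous_snd
  have hc : ContinuousOn (fun q : ℂ × ProjSpace m => affineChart q.2)
      {q | q.2 ∈ affineDomain m} :=
    continuousOn_affineChart.comp continuous_snd.continuousOn fun q hq => hq
  have hcl : ContinuousOn (fun q : ℂ × ProjSpace m => affineChart q.2 (Fin.last m))
      {q | q.2 ∈ affineDomain m} :=
    (EuclideanSpace.proj (Fin.last m) :
      EuclideanSpace ℂ (Fin (m + 1)) →L[ℂ] ℂ).continuous.comp_continuousOn hc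
  have hW : IsOpen W := by
    have h1 := ContinuousOn.isOpen_inter_preimage
      (hc.norm.prodMk (hcl.sub continuous_fst.continuousOn).norm) hD
      ((isOpen_Iio (a := (2 : ℝ))).prod (isOpen_Iio (a := (1 / 4 : ℝ))))
    exact h1
  have hcm : Continuous (toContinuousMap (m := m)) := continuous_induced_dom
  have hpair : Continuous fun f : EntireCurve m =>
      (ContinuousMap.id ℂ).prodMk f.toContinuousMap :=
    ContinuousMap.continuous_of_continuous_uncurry _
      (continuous_snd.prodMk ((hcm.comp continuous_fst).eval continuous_snd))
  exact (ContinuousMap.isOpen_setOfPred_mapsTo (isCompact_closedBall (0 : ℂ) 1) hW).preimage hpair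

/-- The line `z ↦ [1 : 0 : ⋯ : 0 : z]`. -/
noncomputable def line (m : ℕ) (hm : 1 ≤ m) : EntireCurve m where
  toFun z := Projectivization.mk ℂ
    (EuclideanSpace.single 0 1 + z • EuclideanSpace.single (Fin.last m) 1 :
      EuclideanSpace ℂ (Fin (m + 1)))
    (fun h => by
      have := congrArg (fun v : EuclideanSpace ℂ (Fin (m + 1)) => v 0) h
      have h0 : (0 : Fin (m + 1)) ≠ Fin.last m := by
        simp [Fin.ext_iff]; omega
      simp [h0] at this)
  holomorphic' z₀ := by
    refine ⟨fun z => EuclideanSpace.single 0 1 + z • EuclideanSpace.single (Fin.last m) 1,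
      by fun_prop, Eventually.of_forall fun z => ⟨_, rfl⟩⟩

theorem nearLine_nonempty (hm : 1 ≤ m) : (nearLine m).Nonempty := by
  refine ⟨line m hm, fun z hz => ?_⟩
  -- Here `1 ≤ m` matters: for `m = 0` the two coordinates coincide.
  have h0 : (0 : Fin (m + 1)) ≠ Fin.last m := by
    simp [Fin.ext_iff]; omega
  have hz1 : ‖z‖ ≤ 1 := by simpa using hz
  have hchart : affineChart ((line m hm).toFun z) =
      EuclideanSpace.single 0 1 + z • EuclideanSpace.single (Fin.last m) 1 := by
    refine (affineChart_mk _ _).trans ?_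
    simp [h0]
  refine ⟨?_, ?_, ?_⟩
  · change affineChart _ 0 = 1
    rw [hchart]
    simp [h0]
  · rw [hchart]
    have horth : inner ℂ (EuclideanSpace.single 0 1 : EuclideanSpace ℂ (Fin (m + 1)))
        (z • EuclideanSpace.single (Fin.last m) 1) = 0 := by
      simp [EuclideanSpace.inner_single_left, h0]
    have := norm_add_sq_eq_norm_sq_add_norm_sq_of_inner_eq_zero _ _ horth
    simp only [norm_smul, PiLp.norm_single, norm_one, mul_one] at this
    nlinarith [norm_nonneg (EuclideanSpace.single 0 1 + z • EuclideanSpace.single (Fin.last m) 1 :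
      EuclideanSpace ℂ (Fin (m + 1))), norm_nonneg z]
  · rw [hchart]
    simp [h0.symm]

/-- Cauchy's estimate on a circle of radius `1 / 2` puts the derivative of the last coordinate
within `(1 / 4) / (1 / 2) = 1 / 2` of `1`. With chart norm below `2`, the density is at least `(1 /
2)² / (2⁴ π)`. -/
theorem le_pullbackDensity_of_mem_nearLine {f : EntireCurve m} (hf : f ∈ nearLine m) {z : ℂ}
    (hz : z ∈ Metric.ball (0 : ℂ) (1 / 4)) : 1 / (64 * Real.pi) ≤ f.pullbackDensity z := by
  set G : ℂ → EuclideanSpace ℂ (Fin (m + 1)) := fun w => affineChart (f.toFun w) with hG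
  have hsub : Metric.closedBall z (1 / 2) ⊆ Metric.closedBall (0 : ℂ) 1 :=
    Metric.closedBall_subset_closedBall' (by rw [Metric.mem_ball] at hz; linarith)
  have han : ∀ w ∈ Metric.closedBall z (1 / 2), AnalyticAt ℂ G w := fun w hw =>
    (f.isLocalLift_affineChart (hf w (hsub hw)).1).1
  have hzz : z ∈ Metric.closedBall z (1 / 2) := Metric.mem_closedBall_self (by norm_num)
  have hGz : DifferentiableAt ℂ G z := (han z hzz).differentiableAt
  have happ : ∀ (i : Fin (m + 1)) (w : ℂ), DifferentiableAt ℂ G w →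
      HasDerivAt (fun w => G w i) (deriv G w i) w := fun i w hw =>
    (EuclideanSpace.proj i : EuclideanSpace ℂ (Fin (m + 1)) →L[ℂ] ℂ).hasFDerivAt.comp_hasDerivAt w
      hw.hasDerivAt
  have hd0 : deriv G z 0 = 0 := by
    refine (happ 0 z hGz).unique ((hasDerivAt_const z (1 : ℂ)).congr_of_eventuallyEq ?_)
    exact f.continuous_toFun.continuousAt.eventually_mem
      (isOpen_affineDomain.mem_nhds (hf z (hsub hzz)).1)
  have hdl : ‖deriv G z (Fin.last m) - 1‖ ≤ 1 / 2 := by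
    have hder := (happ (Fin.last m) z hGz).sub (hasDerivAt_id z)
    have hdiff : DifferentiableOn ℂ (fun w => G w (Fin.last m) - w)
        (Metric.closedBall z (1 / 2)) := fun w hw =>
      ((happ (Fin.last m) w (han w hw).differentiableAt).differentiableAt.sub
        differentiableAt_id).differentiableWithinAt
    have := Complex.norm_deriv_le_of_forall_mem_sphere_norm_le (c := z) (R := 1 / 2) (C := 1 / 4)
      (by norm_num) (f := fun w => G w (Fin.last m) - w)
      (hdiff.diffContOnCl_ball subset_rfl)
      (fun w hw => (hf w (hsub (Metric.sphere_subset_closedBall hw))).2.2.le)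
    have he : deriv (fun w => G w (Fin.last m) - w) z = deriv G z (Fin.last m) - 1 := hder.deriv
    rw [he] at this
    norm_num at this
    norm_num [this]
  have hlow : 1 / 2 ≤ ‖deriv G z‖ := by
    have h1 : ‖deriv G z (Fin.last m)‖ ≤ ‖deriv G z‖ := PiLp.norm_apply_le _ _
    have h2 := norm_sub_norm_le (1 : ℂ) (1 - deriv G z (Fin.last m))
    rw [sub_sub_cancel, norm_one, norm_sub_rev] at h2
    linarith
  obtain ⟨hz1, hz2, -⟩ := hf z (hsub hzz)
  have hG0 : 0 < ‖G z‖ := norm_pos_iff.2 (affineChart_ne_zero hz1)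
  have hpos := Real.pi_pos
  rw [f.pullbackDensity_eq z G (f.isLocalLift_affineChart hz1)]
  refine le_trans ?_ (le_fubiniStudyForm_I_smul (G z) (deriv G z) hz1 hd0)
  calc 1 / (64 * Real.pi) = 1 / Real.pi * ((1 / 2) ^ 2 / 2 ^ 4) := by field_simp; norm_num
    _ ≤ _ := by gcongr

/-! ### Area and the characteristic function -/

/-- The area of the image of the disc of radius `t`. -/
noncomputable def discArea (h : EntireCurve m) (t : ℝ) : ℝ := ∫ z in Metric.ball (0 : ℂ) t, h.pullbackDensity z

theorem integrableOn_pullbackDensity (h : EntireCurve m) {s : Set ℂ} {t : ℝ}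
    (hs : s ⊆ Metric.ball (0 : ℂ) t) : IntegrableOn h.pullbackDensity s :=
  (h.continuous_pullbackDensity.continuousOn.integrableOn_compact
    (isCompact_closedBall (0 : ℂ) t)).mono_set (hs.trans Metric.ball_subset_closedBall)

theorem discArea_nonneg (h : EntireCurve m) (t : ℝ) : 0 ≤ h.discArea t :=
  setIntegral_nonneg Metric.isOpen_ball.measurableSet fun z _ => h.pullbackDensity_nonneg z

theorem setIntegral_le_discArea (h : EntireCurve m) {s : Set ℂ} {t : ℝ}
    (hs : s ⊆ Metric.ball (0 : ℂ) t) : ∫ z in s, h.pullbackDensity z ≤ h.discArea t :=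
  setIntegral_mono_set (h.integrableOn_pullbackDensity subset_rfl)
    (Eventually.of_forall h.pullbackDensity_nonneg) (Eventually.of_forall hs)

theorem monotone_discArea (h : EntireCurve m) : Monotone h.discArea := fun _ _ hst =>
  h.setIntegral_le_discArea (Metric.ball_subset_ball hst)

/-- The area is `O(t²)`, so dividing by `t` leaves a bounded integrand. Without integrability the
integral would default to `0`. -/
theorem intervalIntegrable_discArea_div (h : EntireCurve m) {r : ℝ} (hr : 0 ≤ r) :
    IntervalIntegrable (fun t => h.discArea t / t) volume 0 r := by
  obtain ⟨M, hM⟩ := (isCompact_closedBall (0 : ℂ) r).exists_bound_of_continuousOn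
    h.continuous_pullbackDensity.continuousOn
  have hM0 : 0 ≤ M := (norm_nonneg _).trans (hM 0 (Metric.mem_closedBall_self hr))
  rw [intervalIntegrable_iff_integrableOn_Ioc_of_le hr]
  refine Measure.integrableOn_of_bounded (M := M * Real.pi * r) (by simp)
    ((h.monotone_discArea.measurable.div measurable_id).aestronglyMeasurable) ?_
  refine (ae_restrict_iff' measurableSet_Ioc).2 (Eventually.of_forall fun t ht => ?_)
  have hvol : volume.real (Metric.ball (0 : ℂ) t) = t ^ 2 * Real.pi := by
    simp [Measure.real, Complex.volume_ball, ht.1.le]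
  have hb : ‖h.discArea t‖ ≤ M * volume.real (Metric.ball (0 : ℂ) t) :=
    norm_setIntegral_le_of_norm_le_const measure_ball_lt_top fun z hz =>
      hM z (Metric.closedBall_subset_closedBall ht.2 (Metric.ball_subset_closedBall hz))
  rw [hvol] at hb
  rw [norm_div, Real.norm_of_nonneg ht.1.le, div_le_iff₀ ht.1]
  refine hb.trans ?_
  have h2 : M * Real.pi * t * t ≤ M * Real.pi * r * t := by
    have := ht.1; have := ht.2; have := Real.pi_pos
    gcongr
  linarith

/-- Linear growth of the area gives linear growth of the characteristic function. -/
theorem le_characteristic (h : EntireCurve m) {b t₀ r : ℝ} (ht₀ : 0 < t₀) (hr : t₀ ≤ r)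
    (hb : ∀ t, t₀ ≤ t → b * t ≤ h.discArea t) : b * (r - t₀) ≤ h.characteristic r := by
  have hint := h.intervalIntegrable_discArea_div (ht₀.le.trans hr)
  have hi1 := hint.mono_set (c := 0) (d := t₀) (by
    rw [uIcc_of_le ht₀.le, uIcc_of_le (ht₀.le.trans hr)]; exact Icc_subset_Icc_right hr)
  have hi2 := hint.mono_set (c := t₀) (d := r) (by
    rw [uIcc_of_le hr, uIcc_of_le (ht₀.le.trans hr)]; exact Icc_subset_Icc_left ht₀.le)
  have hsplit : h.characteristic r = (∫ t in (0 : ℝ)..t₀, h.discArea t / t) +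
      ∫ t in t₀..r, h.discArea t / t :=
    (intervalIntegral.integral_add_adjacent_intervals hi1 hi2).symm
  have h1 : 0 ≤ ∫ t in (0 : ℝ)..t₀, h.discArea t / t :=
    intervalIntegral.integral_nonneg ht₀.le fun t ht => div_nonneg (h.discArea_nonneg t) ht.1
  have h2 : ∫ _ in t₀..r, b ≤ ∫ t in t₀..r, h.discArea t / t :=
    intervalIntegral.integral_mono_on hr (by simp) hi2 fun t ht =>
      (le_div_iff₀ (ht₀.trans_le ht.1)).2 (hb t ht.1)
  rw [intervalIntegral.integral_const, smul_eq_mul] at h2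
  linarith

/-- Disjoint discs of radius `1 / 4` on which the density is at least `1 / (64 π)`. -/
theorem card_le_discArea {ι : Type*} (h : EntireCurve m) (I : Finset ι) (c : ι → ℂ) {t : ℝ}
    (hdisj : ∀ i ∈ I, ∀ j ∈ I, i ≠ j → 1 / 2 ≤ dist (c i) (c j))
    (hsub : ∀ i ∈ I, Metric.ball (c i) (1 / 4) ⊆ Metric.ball (0 : ℂ) t)
    (hd : ∀ i ∈ I, ∀ z ∈ Metric.ball (c i) (1 / 4), 1 / (64 * Real.pi) ≤ h.pullbackDensity z) :
    (I.card : ℝ) / 1024 ≤ h.discArea t := by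
  have hpw : (I : Set ι).Pairwise (Function.onFun Disjoint fun i => Metric.ball (c i) (1 / 4)) :=
    fun i hi j hj hij => Metric.ball_disjoint_ball (by
      have := hdisj i hi j hj hij
      linarith)
  have hU := integral_biUnion_finset I (fun i _ => Metric.isOpen_ball.measurableSet) hpw
    fun i hi => h.integrableOn_pullbackDensity (hsub i hi)
  refine le_trans ?_ (h.setIntegral_le_discArea (iUnion₂_subset hsub))
  rw [hU, div_eq_mul_one_div, ← nsmul_eq_mul]
  refine Finset.card_nsmul_le_sum _ _ _ fun i hi => ?_
  -- Each disc contributes `(π / 16) * 1 / (64 π) = 1 / 1024`.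
  have hvol : volume.real (Metric.ball (c i) (1 / 4)) = (1 / 4) ^ 2 * Real.pi := by
    simp [Measure.real, Complex.volume_ball]
  have := setIntegral_ge_of_const_le_real Metric.isOpen_ball.measurableSet measure_ball_lt_top.ne
    (hd i hi) (h.integrableOn_pullbackDensity (hsub i hi))
  rw [hvol] at this
  refine le_trans (le_of_eq ?_) this
  have := Real.pi_ne_zero
  field_simp
  norm_num

end EntireCurve

/-! ### Counting disjoint discs along rays -/

/-- Separates far points on distinct rays: move `y * v` to `x * v` at cost `|x - y|`, itself at most
the distance by the reverse triangle inequality. -/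
theorem norm_mul_sub_le_two_mul_dist {u v : ℂ} (hu : ‖u‖ = 1) (hv : ‖v‖ = 1) (x y : ℝ)
    (hx : 0 ≤ x) (hy : 0 ≤ y) : x * ‖u - v‖ ≤ 2 * dist (x * u) (y * v) := by
  have h1 : |x - y| ≤ ‖(x : ℂ) * u - y * v‖ := by
    have := abs_norm_sub_norm_le ((x : ℂ) * u) (y * v)
    simpa [hu, hv, abs_of_nonneg hx, abs_of_nonneg hy] using this
  have h2 : ‖((y : ℂ) - x) * v‖ = |x - y| := by
    rw [norm_mul, hv, mul_one, ← Complex.ofReal_sub, Complex.norm_real, Real.norm_eq_abs, abs_sub_comm]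
  have h3 : x * ‖u - v‖ = ‖((x : ℂ) * u - y * v) + ((y : ℂ) - x) * v‖ := by
    have : ((x : ℂ) * u - y * v) + ((y : ℂ) - x) * v = x * (u - v) := by ring
    rw [this, norm_mul, Complex.norm_real, Real.norm_of_nonneg hx]
  rw [h3, dist_eq_norm]
  linarith [norm_add_le ((x : ℂ) * u - y * v) (((y : ℂ) - x) * v)]

theorem eventually_lt_ncard_of_lt_lowerDensity {A : Set ℕ} {δ : ℝ} (h : δ < lowerDensity A) :
    ∀ᶠ N : ℕ in atTop, δ * N < ({n : ℕ | n ≤ N ∧ n ∈ A}.ncard : ℝ) := by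
  -- A real `liminf` is meaningful only with such a bound.
  have hb : IsBoundedUnder (· ≥ ·) atTop
      (fun N : ℕ => ({n : ℕ | n ≤ N ∧ n ∈ A}.ncard : ℝ) / N) :=
    isBoundedUnder_of ⟨0, fun N => by positivity⟩
  filter_upwards [eventually_lt_of_lt_liminf h hb, eventually_gt_atTop 0] with N hN hN0
  rwa [lt_div_iff₀ (by exact_mod_cast hN0)] at hN

/-- If the translates of `h` along finitely many rays are near the line with lower density
exceeding `δ`, then the area grows at least linearly, with a factor proportional to the number
of rays. -/
theorem EntireCurve.exists_le_discArea {m : ℕ} (h : EntireCurve m) (Θ : Finset ℝ) {δ : ℝ}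
    (hδ : 0 < δ) (hΘ : ∀ θ ∈ Θ, θ ∈ Ico 0 (2 * Real.pi))
    (hd : ∀ θ ∈ Θ, δ < lowerDensity
      {n : ℕ | (translation m (Complex.exp (Complex.I * θ)))^[n] h ∈ nearLine m}) :
    ∃ t₀ > 0, ∀ t, t₀ ≤ t → Θ.card * δ / 2048 * t ≤ h.discArea t := by
  classical
  set u : ℝ → ℂ := fun θ => Complex.exp (Complex.I * θ) with hu
  have hu1 : ∀ θ, ‖u θ‖ = 1 := fun θ => Complex.norm_exp_I_mul_ofReal θ
  set S : ℝ → Set ℕ := fun θ => {n | (translation m (u θ))^[n] h ∈ nearLine m} with hS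
  have huinj : ∀ θ ∈ Θ, ∀ η ∈ Θ, θ ≠ η → 0 < ‖u θ - u η‖ := by
    intro θ hθ η hη hne
    rw [norm_pos_iff, sub_ne_zero]
    intro he
    apply hne
    refine Circle.exp_injOn_Ico (by simp) (hΘ θ hθ) (hΘ η hη) ?_
    ext
    simpa [hu, mul_comm Complex.I] using he
  -- Beyond `n₀`, centres on distinct rays are at least `1 / 2` apart.
  obtain ⟨n₀, hn₀⟩ : ∃ n₀ : ℕ, ∀ n : ℕ, n₀ ≤ n → ∀ θ ∈ Θ, ∀ η ∈ Θ, θ ≠ η →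
      1 ≤ n * ‖u θ - u η‖ := by
    rw [← eventually_atTop]
    simp only [Filter.eventually_all_finset, Filter.eventually_imp_distrib_left]
    intro θ hθ η hη hne
    exact (tendsto_natCast_atTop_atTop.atTop_mul_const (huinj θ hθ η hη hne)).eventually_ge_atTop 1
  obtain ⟨N₀, hN₀⟩ : ∃ N₀ : ℕ, ∀ N : ℕ, N₀ ≤ N → ∀ θ ∈ Θ,
      δ * N < ({n : ℕ | n ≤ N ∧ n ∈ S θ}.ncard : ℝ) := by
    rw [← eventually_atTop]
    simp only [Filter.eventually_all_finset]
    exact fun θ hθ => eventually_lt_ncard_of_lt_lowerDensity (hd θ hθ)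
  -- The term `N₀ + 2` gives `N₀ ≤ N`; the last one makes `δ * (t - 2) - n₀ ≥ δ * t / 2`, absorbing
  -- the rounding of `t` and the discarded `n < n₀`.
  refine ⟨N₀ + 2 + 2 * (2 * δ + n₀) / δ, by positivity, fun t ht => ?_⟩
  have hq : 0 ≤ 2 * (2 * δ + n₀) / δ := by positivity
  have ht2 : N₀ + 2 ≤ t := by linarith
  -- The margin `N + 1 ≤ t` keeps the discs about points of modulus at most `N` inside the ball of
  -- radius `t`.
  obtain ⟨N, hN1, hN2⟩ : ∃ N : ℕ, (N : ℝ) + 1 ≤ t ∧ t ≤ N + 2 := by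
    have h1 : 1 ≤ ⌊t⌋₊ := Nat.one_le_floor_iff _ |>.2 (by
      have : (0 : ℝ) ≤ N₀ := by positivity
      linarith)
    refine ⟨⌊t⌋₊ - 1, ?_, ?_⟩
    · have := Nat.floor_le (a := t) (by
        have : (0 : ℝ) ≤ N₀ := by positivity
        linarith)
      push_cast [h1]
      linarith
    · have := Nat.lt_floor_add_one t
      push_cast [h1]
      linarith
  have hNN : N₀ ≤ N := by
    have : (N₀ : ℝ) ≤ N := by linarith
    exact_mod_cast this
  let A : ℝ → Finset ℕ := fun θ => {n ∈ Finset.Ico n₀ (N + 1) | n ∈ S θ}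
  have hA : ∀ θ ∈ Θ, δ * t / 2 ≤ (A θ).card := by
    intro θ hθ
    have h1 := hN₀ N hNN θ hθ
    have h2 : {n : ℕ | n ≤ N ∧ n ∈ S θ}.ncard ≤ n₀ + (A θ).card := by
      have hsub : {n : ℕ | n ≤ N ∧ n ∈ S θ} ⊆ ↑(Finset.range n₀ ∪ A θ) := by
        rintro n ⟨hn1, hn2⟩
        simp only [A, Finset.coe_union, Finset.coe_filter, Finset.mem_Ico, mem_union,
          Finset.coe_range, mem_Iio, mem_ofPred_eq]
        by_cases hn : n < n₀
        · exact Or.inl hn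
        · exact Or.inr ⟨⟨by omega, by omega⟩, hn2⟩
      calc _ ≤ (↑(Finset.range n₀ ∪ A θ) : Set ℕ).ncard := ncard_le_ncard hsub (Finset.finite_toSet _)
        _ ≤ _ := by
          rw [ncard_coe_finset]
          simpa using Finset.card_union_le (Finset.range n₀) (A θ)
    have h3 : ({n : ℕ | n ≤ N ∧ n ∈ S θ}.ncard : ℝ) ≤ n₀ + (A θ).card := by exact_mod_cast h2
    have h4 : 2 * (2 * δ + n₀) ≤ δ * t := by
      have : 2 * (2 * δ + n₀) / δ ≤ t := by
        have : (0 : ℝ) ≤ N₀ := by positivity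
        linarith
      rw [div_le_iff₀ hδ] at this
      linarith
    nlinarith
  let I : Finset (Σ _ : ℝ, ℕ) := Θ.sigma A
  have hcard : Θ.card * (δ * t / 2) ≤ (I.card : ℝ) := by
    rw [Finset.card_sigma]
    push_cast
    rw [← nsmul_eq_mul]
    exact Finset.card_nsmul_le_sum _ _ _ hA
  have hmem : ∀ i ∈ I, i.1 ∈ Θ ∧ n₀ ≤ i.2 ∧ i.2 ≤ N ∧ i.2 ∈ S i.1 := by
    rintro ⟨θ, n⟩ hi
    simp only [I, A, Finset.mem_sigma, Finset.mem_filter, Finset.mem_Ico] at hi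
    exact ⟨hi.1, hi.2.1.1, Nat.lt_succ_iff.1 hi.2.1.2, hi.2.2⟩
  have key := h.card_le_discArea I (fun i => (i.2 : ℂ) * u i.1) (t := t) ?_ ?_ ?_
  · linarith
  · rintro ⟨θ, n⟩ hi ⟨η, k⟩ hj hij
    obtain ⟨h1, h2, -, -⟩ := hmem _ hi
    obtain ⟨h3, h4, -, -⟩ := hmem _ hj
    simp only at h1 h2 h3 h4 ⊢
    by_cases hθη : θ = η
    · subst hθη
      have hnk : n ≠ k := fun hnk => hij (by rw [hnk])
      rw [dist_eq_norm, ← sub_mul, norm_mul, hu1, mul_one]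
      have : (1 : ℝ) ≤ ‖(n : ℂ) - k‖ := by
        have h5 : (1 : ℤ) ≤ |(n : ℤ) - k| := Int.one_le_abs (by omega)
        have h6 : (n : ℂ) - k = (((n : ℤ) - k : ℤ) : ℂ) := by push_cast; rfl
        rw [h6, Complex.norm_intCast]
        exact_mod_cast h5
      linarith
    · have h5 := norm_mul_sub_le_two_mul_dist (hu1 θ) (hu1 η) n k (by positivity) (by positivity)
      have h6 := hn₀ n h2 θ h1 η h3 hθη
      simp only [Complex.ofReal_natCast] at h5
      linarith
  · rintro ⟨θ, n⟩ hi
    obtain ⟨-, -, h3, -⟩ := hmem _ hi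
    apply Metric.ball_subset_ball'
    have h4 : (n : ℝ) ≤ N := by exact_mod_cast h3
    simp only [dist_zero_right, norm_mul, hu1, mul_one, Complex.norm_natCast]
    linarith
  · rintro ⟨θ, n⟩ hi z hz
    obtain ⟨-, -, -, h4⟩ := hmem _ hi
    simp only [hS, mem_ofPred_eq, iterate_translation_toFun] at h4
    have := le_pullbackDensity_of_mem_nearLine h4 (z := z - n * u θ) (by
      simpa [Metric.mem_ball, dist_eq_norm] using hz)
    rwa [pullbackDensity_translate, sub_add_cancel] at this

/-! ### Countability of the set of directions -/

theorem proposition1p4 (m : ℕ) (hm : 1 ≤ m) (h : EntireCurve m) (ε : ℝ) (hε : 0 < ε)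
    (hT : ∀ r : ℝ, 0 < r → h.characteristic r ≤ ε * r) :
    {θ : ℝ | θ ∈ Set.Ico 0 (2 * Real.pi) ∧
      h ∈ FHC (EntireCurve.translation m (Complex.exp (Complex.I * θ)))}.Countable := by
  let D : ℝ → ℝ := fun θ => lowerDensity {n : ℕ |
    (EntireCurve.translation m (Complex.exp (Complex.I * θ)))^[n] h ∈ EntireCurve.nearLine m}
  have hfin : ∀ k : ℕ,
      {θ : ℝ | θ ∈ Ico 0 (2 * Real.pi) ∧ 1 / ((k : ℝ) + 1) < D θ}.Finite := by
    intro k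
    by_contra hinf
    have hδ : (0 : ℝ) < 1 / ((k : ℝ) + 1) := by positivity
    set δ : ℝ := 1 / ((k : ℝ) + 1)
    -- This makes the slope `K * δ / 2048` exceed `2 * ε`. At `r = 2 * t₀` the lower bound is slope
    -- times `t₀`, the upper bound `2 * ε * t₀`.
    obtain ⟨K, hK⟩ := exists_nat_gt (2 * ε * 2048 / δ)
    obtain ⟨Θ, hΘ, hcard⟩ := Set.Infinite.exists_subset_card_eq hinf K
    obtain ⟨t₀, ht₀, ht⟩ := h.exists_le_discArea Θ hδ (fun θ hθ => (hΘ hθ).1)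
      fun θ hθ => (hΘ hθ).2
    have h1 := h.le_characteristic ht₀ (r := 2 * t₀) (by linarith) ht
    have h2 := hT (2 * t₀) (by linarith)
    rw [div_lt_iff₀ hδ] at hK
    rw [hcard] at h1
    nlinarith
  refine (countable_iUnion fun k => (hfin k).countable).mono ?_
  rintro θ ⟨hθ, hθF⟩
  obtain ⟨k, hk⟩ := exists_nat_one_div_lt
    (hθF _ EntireCurve.isOpen_nearLine (EntireCurve.nearLine_nonempty hm))
  exact mem_iUnion.2 ⟨k, hθ, hk⟩
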